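/- **Setting.** A seller offers finitely many services $J$ to finitely many agents $I$; $J$ is partitioned into sets $J_i$ ($i\in I$), the services in $J_i$ being targeted at agent $i$. The values $v_j\ge 0$ ($j\in J$) are independent, $v_j\sim F_j$. The seller may allocate any set in a nonempty downward closed system $\mathcal J\subseteq 2^J$ with $|S\cap J_i|\le 1$ for all $S\in\mathcal J$ and $i\in I$. Call this multi-parameter unit-demand instance $\mathcal I$. The single-parameter instance $\mathcal I^{\rm copies}$ has one agent for each $j\in J$, with value $v_j\sim F_j$ independently for being served, and the same feasible sets $\mathcal J$. A (deterministic) mechanism maps each vector $v\in[0,\infty)^J$ of reported values to a set $M(v)\in\mathcal J$ and a payment $\pi_i(v)\in\mathbb R$ of each agent. It is truthful if reporting the true values is a dominant strategy of every agent and it is individually rational: an agent pays at most her value for the service that she gets, and pays $0$ if she gets none. Its revenue is the expected total payment when all reports are true. $\mathrm{OPT}(\mathcal I)$ and $\mathrm{OPT}(\mathcal I^{\rm copies})$ denote the suprema in $[0,\infty]$ of the revenues of such truthful deterministic mechanisms for the two instances (over those whose expected revenue is well defined). An order-oblivious posted pricing (OPM) consists of prices $p_j\ge 0$ ($j\in J$)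 and a nonempty downward closed system $\mathcal J'\subseteq\mathcal J$ ($\mathcal J'=\mathcal J$ is allowed). For values $v$ let $\mathcal S_v$ be the family of inclusion-maximal sets among those $S\in\mathcal J'$ with $v_j\ge p_j$ for all $j\in S$. The revenue of the OPM for $\mathcal I^{\rm copies}$ is $\mathcal R(p,\mathcal J')=\mathbb E_v\bigl[\min_{S\in\mathcal S_v}\sum_{j\in S}p_j\bigr]$. The posted-price menu mechanism of $(p,\mathcal J')$ for $\mathcal I$ with arrival order $\sigma$ approaches the agents one after the other in the order $\sigma$. When agent $i$ arrives and $A$ is the set of services already allocated, $i$ is offered every $j\in J_i$ with $A\cup\{j\}\in\mathcal J'$ at price $p_j$. If some offered $j$ has $v_j\ge p_j$, she buys an offered service that maximizes $v_j-p_j$; otherwise she buys nothing. Ties between services are broken by an arbitrary measurable rule that depends only on the menu and the agent's values for the services on it. **Theorem.** Let $\alpha\ge 0$ and let $(p,\mathcal J')$ be an OPM with $\mathrm{OPT}(\mathcal I^{\rm copies})\le\alpha\,\mathcal R(p,\mathcal J')$, that is, an $\alpha$-approximate OPM for $\mathcal I^{\rm copies}$. Then, for every tie-breaking rule: 1. for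 every arrival order $\sigma$, the posted-price menu mechanism of $(p,\mathcal J')$ is a truthful (and individually rational and feasible) mechanism for $\mathcal I$, and $\mathrm{OPT}(\mathcal I)\le\alpha\cdot R_\sigma$, where $R_\sigma$ is its expected revenue; 2. moreover $\mathrm{OPT}(\mathcal I)\le\alpha\,\mathbb E_v\bigl[\min_\sigma R_\sigma(v)\bigr]$, where $R_\sigma(v)$ is its revenue at values $v$; that is, the approximation holds even if the arrival order is picked adversarially with knowledge of all values. In particular, if $\mathcal I^{\rm copies}$ has an $\alpha$-approximate OPM, then $\mathcal I$ has a truthful posted-price mechanism that $\alpha$-approximates the optimal deterministic truthful mechanism. -/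

import Mathlib

open MeasureTheory
open scoped NNReal ENNReal

noncomputable section

/-- The expectation of a real random variable as an extended real number: the expectation of the
positive part minus that of the negative part. When both are infinite the value is `⊥`
(so that a mechanism without a well-defined revenue never contributes to a supremum). -/
def extendedExpectation {Ω : Type*} [MeasurableSpace Ω] (μ : Measure Ω) (f : Ω → ℝ) : EReal :=
  ((∫⁻ ω, ENNReal.ofReal (f ω) ∂μ : ℝ≥0∞) : EReal) -
    ((∫⁻ ω, ENNReal.ofReal (-f ω) ∂μ : ℝ≥0∞) : EReal)

/-- A deterministic direct mechanism with set of agents `I` and set of services `J`: it maps a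
vector of reported values (one nonnegative value per service) to the set of services that are
allocated and to a payment for every agent. -/
structure Mechanism (I J : Type*) where
  alloc : (J → ℝ≥0) → Finset J
  pay : (J → ℝ≥0) → I → ℝ

/-- The allocation rule and the payments are measurable functions of the values. -/
def Mechanism.IsMeasurable {I J : Type*} (M : Mechanism I J) : Prop :=
  (∀ S : Finset J, MeasurableSet {v : J → ℝ≥0 | M.alloc v = S}) ∧
    ∀ i : I, Measurable fun v : J → ℝ≥0 => M.pay v i

/-- The expected total payment when the values are independent with `v j ∼ dist j`. -/
def Mechanism.revenue {I J : Type*} [Fintype I] [Fintype J] (M : Mechanism I J)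
    (dist : J → ProbabilityMeasure ℝ≥0) : EReal :=
  extendedExpectation (Measure.pi fun j => (dist j : Measure ℝ≥0)) fun v => ∑ i, M.pay v i

/-! ### Single-parameter instances -/

/-- An instance of Bayesian single-parameter mechanism design with set of agents `N`: independent
value distributions, and a nonempty downward closed system of feasible sets of agents. -/
structure BSMD (N : Type*) [Fintype N] where
  dist : N → ProbabilityMeasure ℝ≥0
  feasible : Set (Finset N)
  empty_mem : ∅ ∈ feasible
  down_closed : ∀ A B : Finset N, A ⊆ B → B ∈ feasible → A ∈ feasible

namespace BSMD

variable {N : Type*} [Fintype N]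

open Classical in
/-- Utility of agent `i` with true value `x` when the reported values are `b`. -/
def utility (M : Mechanism N N) (i : N) (x : ℝ≥0) (b : N → ℝ≥0) : ℝ :=
  (if i ∈ M.alloc b then (x : ℝ) else 0) - M.pay b i

/-- Feasible, measurable, dominant strategy truthful and individually rational deterministic
mechanisms. -/
structure IsTruthfulMechanism (B : BSMD N) (M : Mechanism N N) : Prop where
  measurable : M.IsMeasurable
  feasible : ∀ v, M.alloc v ∈ B.feasible
  truthful : ∀ (i : N) (v b : N → ℝ≥0), (∀ k, k ≠ i → b k = v k) →
    utility M i (v i) b ≤ utility M i (v i) v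
  pay_le : ∀ v i, i ∈ M.alloc v → M.pay v i ≤ v i
  pay_zero : ∀ v i, i ∉ M.alloc v → M.pay v i = 0

/-- The optimal revenue of a truthful mechanism. -/
def optRevenue (B : BSMD N) : EReal :=
  ⨆ (M : Mechanism N N) (_ : B.IsTruthfulMechanism M), M.revenue B.dist

end BSMD

/-- An order-oblivious posted pricing for the set system `𝓙`: one price per element, and a
nonempty downward closed system `allowed ⊆ 𝓙` that is used to determine feasibility. The choice
`allowed = 𝓙` gives order-oblivious posted pricings without a restricted feasibility constraint. -/
structure OPM {N : Type*} (𝓙 : Set (Finset N)) where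
  price : N → ℝ≥0
  allowed : Set (Finset N)
  allowed_subset : allowed ⊆ 𝓙
  empty_mem : ∅ ∈ allowed
  down_closed : ∀ A B : Finset N, A ⊆ B → B ∈ allowed → A ∈ allowed

/-- The maximal feasible sets of agents that desire service at values `v`. -/
def OPM.maximalSets {N : Type*} {𝓙 : Set (Finset N)} (P : OPM 𝓙) (v : N → ℝ≥0) :
    Set (Finset N) :=
  {S | Maximal (fun T : Finset N => T ∈ P.allowed ∧ ∀ i ∈ T, P.price i ≤ v i) S}

/-- The (pessimistic) expected revenue of an order-oblivious posted pricing for a single-parameter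
instance: the expected value of the least total price of a maximal feasible set of agents that
desire service. -/
def BSMD.opmRevenue {N : Type*} [Fintype N] (B : BSMD N) (P : OPM B.feasible) : ℝ≥0∞ :=
  ∫⁻ v, ⨅ S ∈ P.maximalSets v, ∑ i ∈ S, (P.price i : ℝ≥0∞)
    ∂(Measure.pi fun j => (B.dist j : Measure ℝ≥0))

/-! ### Multi-parameter unit-demand instances -/

/-- An instance of Bayesian multi-parameter unit-demand mechanism design with set of agents `I` and
set of services `J`: the service `j` is targeted at the agent `owner j`, the values for the
services are independent, and the seller faces a nonempty downward closed system of feasible sets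
of services, each of which contains at most one service per agent. -/
structure BMUMD (I J : Type*) [Fintype I] [Fintype J] where
  owner : J → I
  dist : J → ProbabilityMeasure ℝ≥0
  feasible : Set (Finset J)
  empty_mem : ∅ ∈ feasible
  down_closed : ∀ A B : Finset J, A ⊆ B → B ∈ feasible → A ∈ feasible
  unit_demand : ∀ S ∈ feasible, ∀ j ∈ S, ∀ k ∈ S, owner j = owner k → j = k

/-- Agents consider the offers of a price menu with prices `p`. If no service on the menu `K` has
a value of at least its price, the agent buys nothing; otherwise it buys a service that maximizes
value minus price over the menu. Ties between services are broken by an arbitrary (measurable)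
rule that depends on the menu and on the values of the services on it. -/
structure DemandRule {J : Type*} (p : J → ℝ≥0) where
  choose : Finset J → (J → ℝ≥0) → Option J
  measurable : ∀ K o, MeasurableSet {v : J → ℝ≥0 | choose K v = o}
  congr : ∀ K v w, (∀ j ∈ K, v j = w j) → choose K v = choose K w
  mem : ∀ K v j, choose K v = some j → j ∈ K
  price_le : ∀ K v j, choose K v = some j → p j ≤ v j
  optimal : ∀ K v j, choose K v = some j →
    ∀ k ∈ K, (v k : ℝ) - p k ≤ (v j : ℝ) - p j
  lt_price : ∀ K v, choose K v = none → ∀ k ∈ K, v k < p k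

open Classical in
/-- Demand rules exist for all prices. -/
theorem DemandRule.nonempty {J : Type*} [Fintype J] (p : J → ℝ≥0) :
    Nonempty (DemandRule p) := by
  let A : Finset J → (J → ℝ≥0) → Finset J := fun K v =>
    K.filter fun j => p j ≤ v j ∧ ∀ k ∈ K, (v k : ℝ) - p k ≤ (v j : ℝ) - p j
  have hA : ∀ K v j, (A K v).toList.head? = some j → j ∈ A K v := fun K v j h =>
    Finset.mem_toList.1 (List.mem_of_mem_head? h)
  refine ⟨⟨fun K v => (A K v).toList.head?, ?_, ?_, ?_, ?_, ?_, ?_⟩⟩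
  · intro K o
    have h1 : {v : J → ℝ≥0 | (A K v).toList.head? = o} =
        ⋃ B ∈ {B : Finset J | B.toList.head? = o}, ⋂ j, {v | j ∈ A K v ↔ j ∈ B} := by
      ext v
      simp only [Set.mem_ofPred_eq, Set.mem_iUnion, Set.mem_iInter, exists_prop]
      constructor
      · intro h
        exact ⟨A K v, h, fun j => Iff.rfl⟩
      · rintro ⟨B, hB, h⟩
        rw [Finset.ext h]
        exact hB
    rw [h1]
    refine MeasurableSet.biUnion (Set.to_countable _) fun B _ => MeasurableSet.iInter fun j => ?_
    have h2 : MeasurableSet {v : J → ℝ≥0 | j ∈ A K v} := by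
      have h3 : {v : J → ℝ≥0 | j ∈ A K v} = {v | j ∈ K} ∩ ({v | p j ≤ v j} ∩
          ⋂ k ∈ K, {v | (v k : ℝ) - p k ≤ (v j : ℝ) - p j}) := by
        ext v
        simp [A]
      rw [h3]
      refine (MeasurableSet.const _).inter ((measurableSet_le measurable_const
        (measurable_pi_apply j)).inter (MeasurableSet.biInter (Set.to_countable _)
          fun k _ => measurableSet_le ?_ ?_))
      · exact (measurable_pi_apply k).coe_nnreal_real.sub_const _
      · exact (measurable_pi_apply j).coe_nnreal_real.sub_const _
    by_cases hj : j ∈ B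
    · simp only [hj, iff_true]
      exact h2
    · simp only [hj, iff_false]
      exact h2.compl
  · intro K v w h
    have : A K v = A K w := by
      refine Finset.filter_congr fun j hj => ?_
      rw [h j hj]
      exact and_congr_right fun _ => forall₂_congr fun k hk => by rw [h k hk]
    simp only [this]
  · intro K v j h
    exact (Finset.mem_filter.1 (hA K v j h)).1
  · intro K v j h
    exact (Finset.mem_filter.1 (hA K v j h)).2.1
  · intro K v j h
    exact (Finset.mem_filter.1 (hA K v j h)).2.2
  · intro K v h k hk
    by_contra hlt
    have hlt : p k ≤ v k := not_lt.1 hlt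
    obtain ⟨j, hj, hmax⟩ := K.exists_max_image (fun j => (v j : ℝ) - p j) ⟨k, hk⟩
    have hjA : j ∈ A K v := by
      refine Finset.mem_filter.2 ⟨hj, ?_, hmax⟩
      have h1 := hmax k hk
      have h2 : (p k : ℝ) ≤ v k := by exact_mod_cast hlt
      have h3 : (p j : ℝ) ≤ v j := by linarith
      exact_mod_cast h3
    have h4 : (A K v).toList = [] := by simpa using h
    rw [Finset.toList_eq_nil] at h4
    simp [h4] at hjA

/-- An order in which all agents arrive, each of them once. -/
abbrev ArrivalOrder (I : Type*) := {l : List I // l.Nodup ∧ ∀ i, i ∈ l}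

namespace BMUMD

variable {I J : Type*} [Fintype I] [Fintype J]

open Classical in
/-- Utility of the (unit-demand) agent `i` with true values `x` when the reported values are `b`:
its largest value for a service that it receives, minus its payment. -/
def utility (𝓘 : BMUMD I J) (M : Mechanism I J) (i : I) (x b : J → ℝ≥0) : ℝ :=
  ((((M.alloc b).filter fun j => 𝓘.owner j = i).sup x : ℝ≥0) : ℝ) - M.pay b i

/-- Feasible, measurable, dominant strategy truthful and individually rational deterministic
mechanisms. -/
structure IsTruthfulMechanism (𝓘 : BMUMD I J) (M : Mechanism I J) : Prop where
  measurable : M.IsMeasurable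
  feasible : ∀ v, M.alloc v ∈ 𝓘.feasible
  truthful : ∀ (i : I) (v b : J → ℝ≥0), (∀ j, 𝓘.owner j ≠ i → b j = v j) →
    𝓘.utility M i v b ≤ 𝓘.utility M i v v
  pay_le : ∀ v, ∀ j ∈ M.alloc v, M.pay v (𝓘.owner j) ≤ v j
  pay_zero : ∀ v i, (∀ j ∈ M.alloc v, 𝓘.owner j ≠ i) → M.pay v i = 0

/-- The optimal revenue of a deterministic truthful mechanism. -/
def optRevenue (𝓘 : BMUMD I J) : EReal :=
  ⨆ (M : Mechanism I J) (_ : 𝓘.IsTruthfulMechanism M), M.revenue 𝓘.dist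

/-- The single-parameter instance with copies: every service becomes an agent of its own. -/
def copies (𝓘 : BMUMD I J) : BSMD J where
  dist := 𝓘.dist
  feasible := 𝓘.feasible
  empty_mem := 𝓘.empty_mem
  down_closed := 𝓘.down_closed

open Classical in
/-- The services that can be offered to agent `i` when the services in `A` are already taken. -/
def menu (𝓘 : BMUMD I J) (P : OPM 𝓘.feasible) (i : I) (A : Finset J) : Finset J :=
  Finset.univ.filter fun j => 𝓘.owner j = i ∧ insert j A ∈ P.allowed

open Classical in
/-- The services that are sold at the end, when the agents in the given list arrive one after the
other, and each is offered the menu of the services that can still be allocated to it. The set `A`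
holds the services that are already taken. -/
def sold (𝓘 : BMUMD I J) (P : OPM 𝓘.feasible) (d : DemandRule P.price) (v : J → ℝ≥0) :
    List I → Finset J → Finset J
  | [], A => A
  | i :: l, A =>
    match d.choose (𝓘.menu P i A) v with
    | none => sold 𝓘 P d v l A
    | some j => sold 𝓘 P d v l (insert j A)

open Classical in
/-- The posted-price menu mechanism: agents arrive in the order `σ`, buy from their menus, and pay
the posted prices of what they buy. -/
def menuMechanism (𝓘 : BMUMD I J) (P : OPM 𝓘.feasible) (d : DemandRule P.price)
    (σ : ArrivalOrder I) : Mechanism I J where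
  alloc v := 𝓘.sold P d v σ.1 ∅
  pay v i := ∑ j ∈ (𝓘.sold P d v σ.1 ∅).filter (fun j => 𝓘.owner j = i), (P.price j : ℝ)

/-- The expected revenue of posted-price menus when an adversary picks the arrival order with
knowledge of all values. -/
def menuObliviousRevenue (𝓘 : BMUMD I J) (P : OPM 𝓘.feasible) (d : DemandRule P.price) : ℝ≥0∞ :=
  ∫⁻ v, ⨅ σ : ArrivalOrder I, ∑ j ∈ 𝓘.sold P d v σ.1 ∅, (P.price j : ℝ≥0∞)
    ∂(Measure.pi fun j => (𝓘.dist j : Measure ℝ≥0))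

end BMUMD

end

/-! The optimum of the copies instance lies between the two sides. For the upper bound, keep the
allocation of a truthful unit-demand mechanism and charge each sold service its critical report. The
allocation is monotone in the report for each service (`mem_alloc_update`), so this is truthful for
the copies. The original payment for a service is the same at all reports that win it, hence at most
the critical one (`pay_le_threshold`). For the lower bound, in any arrival order the sold services
form a maximal feasible set of desired services (`sold_mem_maximalSets`), so pointwise the menus
earn at least the minimum that defines the OPM revenue. -/

/-! ### Extended expectations. -/

theorem extendedExpectation_mono {Ω : Type*} [MeasurableSpace Ω] (μ : Measure Ω) {f g : Ω → ℝ}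
    (h : ∀ ω, f ω ≤ g ω) : extendedExpectation μ f ≤ extendedExpectation μ g := by
  -- `EReal` subtraction stays monotone with `⊤ - ⊤ = ⊥`, so no integrability is needed.
  refine EReal.sub_le_sub ?_ ?_
  · exact EReal.coe_ennreal_le_coe_ennreal_iff.2
      (lintegral_mono fun ω => ENNReal.ofReal_le_ofReal (h ω))
  · exact EReal.coe_ennreal_le_coe_ennreal_iff.2
      (lintegral_mono fun ω => ENNReal.ofReal_le_ofReal (neg_le_neg (h ω)))

theorem extendedExpectation_of_nonneg {Ω : Type*} [MeasurableSpace Ω] (μ : Measure Ω) {f : Ω → ℝ}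
    (h : ∀ ω, 0 ≤ f ω) :
    extendedExpectation μ f = ((∫⁻ ω, ENNReal.ofReal (f ω) ∂μ : ℝ≥0∞) : EReal) := by
  have h0 : ∀ ω, ENNReal.ofReal (-f ω) = 0 := fun ω =>
    ENNReal.ofReal_of_nonpos (neg_nonpos.2 (h ω))
  simp [extendedExpectation, h0]

/-! ### Critical reports and their measurability. -/

namespace Mechanism

variable {I J : Type*}

open Classical in
/-- The infimum of the rational reports for `j` at which `j` is allocated, the other reports being
fixed. -/
noncomputable def threshold (M : Mechanism I J) (j : J) (v : J → ℝ≥0) : ℝ≥0∞ :=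
  ⨅ q : ℚ, if j ∈ M.alloc (Function.update v j (Real.toNNReal q)) then
    (Real.toNNReal q : ℝ≥0∞) else ⊤

open Classical in
/-- The single-parameter mechanism that allocates the same services as `M` and charges thresholds. -/
noncomputable def thresholdMechanism (M : Mechanism I J) : Mechanism J J where
  alloc := M.alloc
  pay v j := if j ∈ M.alloc v then (M.threshold j v).toReal else 0

theorem threshold_congr (M : Mechanism I J) {j : J} {v b : J → ℝ≥0}
    (h : ∀ k, k ≠ j → b k = v k) : M.threshold j b = M.threshold j v := by
  classical
  have : ∀ x, Function.update b j x = Function.update v j x := fun x => by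
    ext k
    by_cases hk : k = j
    · subst hk; simp
    · simp [Function.update_of_ne hk, h k hk]
  simp only [threshold, this]

theorem IsMeasurable.measurableSet_mem_alloc [Countable J] {M : Mechanism I J}
    (hM : M.IsMeasurable) (j : J) :
    MeasurableSet {v | j ∈ M.alloc v} := by
  have : {v | j ∈ M.alloc v} = ⋃ S ∈ {S : Finset J | j ∈ S}, {v | M.alloc v = S} := by
    ext v
    simp
  rw [this]
  exact MeasurableSet.biUnion (Set.to_countable _) fun S _ => hM.1 S

/-- Restricting the infimum to rational reports makes it countable. -/
theorem IsMeasurable.measurable_threshold [Countable J] {M : Mechanism I J}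
    (hM : M.IsMeasurable) (j : J) : Measurable (M.threshold j) := by
  classical
  refine Measurable.iInf fun q => Measurable.ite ?_ measurable_const measurable_const
  exact measurable_update_left (hM.measurableSet_mem_alloc j)

end Mechanism

namespace BMUMD

/-! ### Upper bound: from unit-demand mechanisms to the copies. -/

section Copies

variable {I J : Type*} [Fintype I] [Fintype J] {𝓘 : BMUMD I J} {M : Mechanism I J}

open Classical in
theorem IsTruthfulMechanism.filter_eq (hM : 𝓘.IsTruthfulMechanism M) {v : J → ℝ≥0} {j : J}
    (hj : j ∈ M.alloc v) :
    (M.alloc v).filter (fun k => 𝓘.owner k = 𝓘.owner j) = {j} := by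
  ext k
  simp only [Finset.mem_filter, Finset.mem_singleton]
  constructor
  · rintro ⟨hk, h⟩
    exact 𝓘.unit_demand _ (hM.feasible v) k hk j hj h
  · rintro rfl
    exact ⟨hj, rfl⟩

theorem IsTruthfulMechanism.utility_eq (hM : 𝓘.IsTruthfulMechanism M) {x v : J → ℝ≥0} {j : J}
    (hj : j ∈ M.alloc v) : 𝓘.utility M (𝓘.owner j) x v = x j - M.pay v (𝓘.owner j) := by
  classical
  unfold utility
  rw [hM.filter_eq hj, Finset.sup_singleton]

open Classical in
/-- Under a truthful mechanism an agent that receives `j` still receives it after raising the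
report for `j`. -/
theorem IsTruthfulMechanism.mem_alloc_update (hM : 𝓘.IsTruthfulMechanism M) {v : J → ℝ≥0} {j : J}
    (hj : j ∈ M.alloc v) {x : ℝ≥0} (hx : v j < x) : j ∈ M.alloc (Function.update v j x) := by
  set w := Function.update v j x with hw
  have hagree : ∀ k, 𝓘.owner k ≠ 𝓘.owner j → v k = w k := fun k hk => by
    rw [hw, Function.update_of_ne (ne_of_apply_ne _ hk)]
  by_contra hjw
  have h1 := hM.truthful (𝓘.owner j) w v hagree
  have h2 := hM.truthful (𝓘.owner j) v w fun k hk => (hagree k hk).symm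
  rw [hM.utility_eq hj] at h1 h2
  -- If `j` is lost at `w`, the bundle received there is worth the same under `v` and `w`. The two
  -- truthfulness inequalities then give `x ≤ v j`.
  have h3 : 𝓘.utility M (𝓘.owner j) w w = 𝓘.utility M (𝓘.owner j) v w := by
    unfold utility
    congr 2
    refine Finset.sup_congr rfl fun k hk => ?_
    have hkj : k ≠ j := fun h => hjw (h ▸ (Finset.mem_filter.1 hk).1)
    rw [hw, Function.update_of_ne hkj]
  have h4 : (w j : ℝ) = x := by rw [hw, Function.update_self]
  have h5 : (v j : ℝ) < x := by exact_mod_cast hx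
  linarith

open Classical in
/-- Under a truthful mechanism the payment for `j` does not depend on the report for `j`. -/
theorem IsTruthfulMechanism.pay_update (hM : 𝓘.IsTruthfulMechanism M) {v : J → ℝ≥0} {j : J}
    (hj : j ∈ M.alloc v) {x : ℝ≥0} (hx : j ∈ M.alloc (Function.update v j x)) :
    M.pay (Function.update v j x) (𝓘.owner j) = M.pay v (𝓘.owner j) := by
  have hagree : ∀ k, 𝓘.owner k ≠ 𝓘.owner j → v k = Function.update v j x k := fun k hk => by
    rw [Function.update_of_ne (ne_of_apply_ne _ hk)]
  have h1 := hM.truthful (𝓘.owner j) (Function.update v j x) v hagree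
  have h2 := hM.truthful (𝓘.owner j) v (Function.update v j x) fun k hk => (hagree k hk).symm
  rw [hM.utility_eq hj, hM.utility_eq hx] at h1 h2
  linarith

/-- By monotonicity every rational report just above `v j` also wins. -/
theorem IsTruthfulMechanism.threshold_le (hM : 𝓘.IsTruthfulMechanism M) {v : J → ℝ≥0} {j : J}
    (hj : j ∈ M.alloc v) : M.threshold j v ≤ v j := by
  refine ENNReal.le_of_forall_pos_le_add fun ε hε _ => ?_
  obtain ⟨q, -, hq, hq'⟩ :=
    (NNReal.lt_iff_exists_rat_btwn (v j) (v j + ε)).1 (lt_add_of_pos_right _ hε)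
  refine (iInf_le _ q).trans ?_
  rw [if_pos (hM.mem_alloc_update hj hq)]
  exact_mod_cast hq'.le

theorem IsTruthfulMechanism.le_threshold (hM : 𝓘.IsTruthfulMechanism M) {v : J → ℝ≥0} {j : J}
    (hj : j ∉ M.alloc v) : (v j : ℝ≥0∞) ≤ M.threshold j v := by
  classical
  refine le_iInf fun q => ?_
  split_ifs with hq
  · by_contra h
    have hlt : Real.toNNReal q < v j := by exact_mod_cast not_le.1 h
    have := hM.mem_alloc_update hq (x := v j) (by rwa [Function.update_self])
    rw [Function.update_idem, Function.update_eq_self] at this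
    exact hj this
  · exact le_top

/-- The payment is unchanged at any winning report `q`, where individual rationality bounds it by
`q`; then take the infimum over `q`. -/
theorem IsTruthfulMechanism.pay_le_threshold (hM : 𝓘.IsTruthfulMechanism M) {v : J → ℝ≥0} {j : J}
    (hj : j ∈ M.alloc v) : M.pay v (𝓘.owner j) ≤ (M.threshold j v).toReal := by
  classical
  have hne : M.threshold j v ≠ ⊤ :=
    ((hM.threshold_le hj).trans_lt ENNReal.coe_lt_top).ne
  rw [← ENNReal.ofReal_le_iff_le_toReal hne]
  refine le_iInf fun q => ?_
  split_ifs with hq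
  · rw [← hM.pay_update hj hq]
    have := hM.pay_le _ j hq
    rw [Function.update_self] at this
    exact (ENNReal.ofReal_le_ofReal this).trans_eq ENNReal.ofReal_coe_nnreal
  · exact le_top

theorem IsTruthfulMechanism.thresholdMechanism (hM : 𝓘.IsTruthfulMechanism M) :
    𝓘.copies.IsTruthfulMechanism M.thresholdMechanism where
  measurable := ⟨hM.measurable.1, fun j => Measurable.ite (hM.measurable.measurableSet_mem_alloc j)
    (hM.measurable.measurable_threshold j).ennreal_toReal measurable_const⟩
  feasible := hM.feasible
  truthful j v b h := by
    have hθ := M.threshold_congr h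
    simp only [BSMD.utility, Mechanism.thresholdMechanism, hθ]
    by_cases hb : j ∈ M.alloc b <;> by_cases hv : j ∈ M.alloc v
    · simp [hb, hv]
    · have h1 := hM.le_threshold hv
      -- Winning at `b` makes the threshold finite; otherwise `toReal` would turn `⊤` into `0`.
      have hne : M.threshold j v ≠ ⊤ :=
        hθ ▸ ((hM.threshold_le hb).trans_lt ENNReal.coe_lt_top).ne
      have h2 := ENNReal.toReal_mono hne h1
      simpa [hb, hv] using h2
    · have h2 := ENNReal.toReal_mono ENNReal.coe_ne_top (hM.threshold_le hv)
      simpa [hb, hv] using h2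
    · simp [hb, hv]
  pay_le v j hj := by
    have h2 := ENNReal.toReal_mono ENNReal.coe_ne_top (hM.threshold_le hj)
    exact (if_pos hj).trans_le h2
  pay_zero v j hj := if_neg hj

/-- Unit demand makes `owner` injective on the allocated set, so the payments of served agents match
the sold services one to one. -/
theorem IsTruthfulMechanism.sum_pay_le (hM : 𝓘.IsTruthfulMechanism M) (v : J → ℝ≥0) :
    ∑ i, M.pay v i ≤ ∑ j, M.thresholdMechanism.pay v j := by
  classical
  have h1 : ∑ i, M.pay v i = ∑ i ∈ (M.alloc v).image 𝓘.owner, M.pay v i := by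
    refine (Finset.sum_subset (Finset.subset_univ _) fun i _ hi => hM.pay_zero v i ?_).symm
    exact fun j hj h => hi (Finset.mem_image.2 ⟨j, hj, h⟩)
  have h2 : ∑ j, M.thresholdMechanism.pay v j =
      ∑ j ∈ M.alloc v, (M.threshold j v).toReal := by
    simp [Mechanism.thresholdMechanism, Finset.sum_ite_mem]
  rw [h1, h2, Finset.sum_image fun j hj k hk h => 𝓘.unit_demand _ (hM.feasible v) j hj k hk h]
  exact Finset.sum_le_sum fun j hj => hM.pay_le_threshold hj

/-- Splitting unit-demand agents into one agent per service does not decrease the optimum. -/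
theorem optRevenue_le_copies (𝓘 : BMUMD I J) : 𝓘.optRevenue ≤ 𝓘.copies.optRevenue := by
  refine iSup₂_le fun M hM => ?_
  refine le_trans ?_ (le_iSup₂ M.thresholdMechanism hM.thresholdMechanism)
  exact extendedExpectation_mono _ hM.sum_pay_le

end Copies

/-! ### Lower bound: the posted-price menu mechanism. -/

section Menu

variable {I J : Type*} [Fintype I] [Fintype J] {𝓘 : BMUMD I J} {P : OPM 𝓘.feasible}
  {d : DemandRule P.price}

open Classical in
theorem mem_menu {i : I} {A : Finset J} {j : J} :
    j ∈ 𝓘.menu P i A ↔ 𝓘.owner j = i ∧ insert j A ∈ P.allowed := by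
  simp [menu]

open Classical in
theorem sold_cons_of_none {v : J → ℝ≥0} {i : I} {A : Finset J}
    (h : d.choose (𝓘.menu P i A) v = none) (l : List I) :
    𝓘.sold P d v (i :: l) A = 𝓘.sold P d v l A := by
  simp [sold, h]

open Classical in
theorem sold_cons_of_some {v : J → ℝ≥0} {i : I} {A : Finset J} {j : J}
    (h : d.choose (𝓘.menu P i A) v = some j) (l : List I) :
    𝓘.sold P d v (i :: l) A = 𝓘.sold P d v l (insert j A) := by
  simp [sold, h]

theorem sold_append (v : J → ℝ≥0) (l₁ l₂ : List I) (A : Finset J) :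
    𝓘.sold P d v (l₁ ++ l₂) A = 𝓘.sold P d v l₂ (𝓘.sold P d v l₁ A) := by
  induction l₁ generalizing A with
  | nil => simp [sold]
  | cons i l ih =>
    rw [List.cons_append]
    rcases h : d.choose (𝓘.menu P i A) v with _ | j
    · rw [sold_cons_of_none h, sold_cons_of_none h, ih]
    · rw [sold_cons_of_some h, sold_cons_of_some h, ih]

theorem subset_sold (v : J → ℝ≥0) (l : List I) (A : Finset J) : A ⊆ 𝓘.sold P d v l A := by
  classical
  induction l generalizing A with
  | nil => simp [sold]
  | cons i l ih =>
    rcases h : d.choose (𝓘.menu P i A) v with _ | j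
    · rw [sold_cons_of_none h]
      exact ih A
    · rw [sold_cons_of_some h]
      exact (Finset.subset_insert j A).trans (ih _)

theorem sold_mem_allowed (v : J → ℝ≥0) (l : List I) {A : Finset J} (hA : A ∈ P.allowed) :
    𝓘.sold P d v l A ∈ P.allowed := by
  induction l generalizing A with
  | nil => simpa [sold] using hA
  | cons i l ih =>
    rcases h : d.choose (𝓘.menu P i A) v with _ | j
    · rw [sold_cons_of_none h]
      exact ih hA
    · rw [sold_cons_of_some h]
      exact ih (mem_menu.1 (d.mem _ _ _ h)).2

theorem price_le_of_mem_sold (v : J → ℝ≥0) (l : List I) {A : Finset J}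
    (hA : ∀ j ∈ A, P.price j ≤ v j) : ∀ j ∈ 𝓘.sold P d v l A, P.price j ≤ v j := by
  classical
  induction l generalizing A with
  | nil => simpa [sold] using hA
  | cons i l ih =>
    rcases h : d.choose (𝓘.menu P i A) v with _ | j
    · rw [sold_cons_of_none h]
      exact ih hA
    · rw [sold_cons_of_some h]
      refine ih fun k hk => ?_
      rcases Finset.mem_insert.1 hk with rfl | hk
      · exact d.price_le _ _ _ h
      · exact hA k hk

open Classical in
theorem filter_sold_of_notMem (v : J → ℝ≥0) {l : List I} {i : I} (hi : i ∉ l) (A : Finset J) :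
    (𝓘.sold P d v l A).filter (fun j => 𝓘.owner j = i) = A.filter fun j => 𝓘.owner j = i := by
  induction l generalizing A with
  | nil => simp [sold]
  | cons k l ih =>
    rw [List.mem_cons, not_or] at hi
    rcases h : d.choose (𝓘.menu P k A) v with _ | j
    · rw [sold_cons_of_none h, ih hi.2]
    · rw [sold_cons_of_some h, ih hi.2, Finset.filter_insert, if_neg]
      rw [(mem_menu.1 (d.mem _ _ _ h)).1]
      exact fun h => hi.1 h.symm

/-- What the agents of a list buy depends only on their own values. -/
theorem sold_congr {v w : J → ℝ≥0} {l : List I} (h : ∀ j, 𝓘.owner j ∈ l → v j = w j)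
    (A : Finset J) : 𝓘.sold P d v l A = 𝓘.sold P d w l A := by
  induction l generalizing A with
  | nil => simp [sold]
  | cons i l ih =>
    have h' : ∀ j, 𝓘.owner j ∈ l → v j = w j := fun j hj => h j (List.mem_cons_of_mem _ hj)
    have hc : d.choose (𝓘.menu P i A) v = d.choose (𝓘.menu P i A) w :=
      d.congr _ _ _ fun j hj => h j ((mem_menu.1 hj).1 ▸ List.mem_cons_self)
    rcases hw : d.choose (𝓘.menu P i A) w with _ | j
    · rw [sold_cons_of_none hw, sold_cons_of_none (hc.trans hw), ih h']
    · rw [sold_cons_of_some hw, sold_cons_of_some (hc.trans hw), ih h']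

open Classical in
/-- In every arrival order, agent `i` gets the service that it chooses from a menu which does not
depend on its own values. -/
theorem exists_filter_sold_eq (d : DemandRule P.price) (σ : ArrivalOrder I) (i : I)
    (v : J → ℝ≥0) :
    ∃ A : Finset J, ∀ b : J → ℝ≥0, (∀ j, 𝓘.owner j ≠ i → b j = v j) →
      A ⊆ 𝓘.sold P d b σ.1 ∅ ∧
      (𝓘.sold P d b σ.1 ∅).filter (fun j => 𝓘.owner j = i) =
        (d.choose (𝓘.menu P i A) b).toFinset := by
  obtain ⟨l, hnd, hl⟩ := σ
  obtain ⟨l₁, l₂, rfl⟩ := List.append_of_mem (hl i)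
  have h₁ : i ∉ l₁ := fun h => (List.disjoint_of_nodup_append hnd) h List.mem_cons_self
  have h₂ : i ∉ l₂ := (List.nodup_cons.1 (List.nodup_append.1 hnd).2.1).1
  -- The witness is what the predecessors of `i` bought. Agents after `i` buy no service of `i`.
  refine ⟨𝓘.sold P d v l₁ ∅, fun b hb => ?_⟩
  have hA : 𝓘.sold P d b l₁ ∅ = 𝓘.sold P d v l₁ ∅ :=
    sold_congr (fun j hj => hb j fun h => h₁ (h ▸ hj)) _
  have hf : (𝓘.sold P d v l₁ ∅).filter (fun j => 𝓘.owner j = i) = ∅ := by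
    rw [filter_sold_of_notMem v h₁, Finset.filter_empty]
  dsimp only
  rw [sold_append, hA]
  refine ⟨subset_sold _ _ _, ?_⟩
  rcases h : d.choose (𝓘.menu P i (𝓘.sold P d v l₁ ∅)) b with _ | j
  · rw [sold_cons_of_none h, filter_sold_of_notMem b h₂, hf]
    rfl
  · rw [sold_cons_of_some h, filter_sold_of_notMem b h₂, Finset.filter_insert, hf,
      if_pos (mem_menu.1 (d.mem _ _ _ h)).1]
    rfl

/-- The services that are sold form a maximal feasible set of desired services. -/
theorem sold_mem_maximalSets (d : DemandRule P.price) (σ : ArrivalOrder I) (v : J → ℝ≥0) :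
    𝓘.sold P d v σ.1 ∅ ∈ P.maximalSets v := by
  classical
  refine ⟨⟨sold_mem_allowed v _ P.empty_mem, price_le_of_mem_sold v _ (by simp)⟩, ?_⟩
  rintro T ⟨hT, hpT⟩ hST j hj
  by_contra hjS
  -- When the owner of `j` arrived, `insert j A ⊆ T` was allowed, so the desired `j` was on the menu
  -- and some `k` was bought. Unit demand in `T` forces `k = j`.
  obtain ⟨A, hA⟩ := exists_filter_sold_eq d σ (𝓘.owner j) v
  obtain ⟨hAS, hf⟩ := hA v fun _ _ => rfl
  have hmenu : j ∈ 𝓘.menu P (𝓘.owner j) A :=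
    mem_menu.2 ⟨rfl, P.down_closed _ T (Finset.insert_subset hj (hAS.trans hST)) hT⟩
  rcases h : d.choose (𝓘.menu P (𝓘.owner j) A) v with _ | k
  · exact (hpT j hj).not_gt (d.lt_price _ _ h j hmenu)
  · have hk : k ∈ (𝓘.sold P d v σ.1 ∅).filter fun m => 𝓘.owner m = 𝓘.owner j := by
      rw [hf, h]
      simp
    rw [Finset.mem_filter] at hk
    have := 𝓘.unit_demand T (P.allowed_subset hT) k (hST hk.1) j hj hk.2
    exact hjS (this ▸ hk.1)

theorem measurableSet_sold_eq (d : DemandRule P.price) (l : List I) (A S : Finset J) :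
    MeasurableSet {v | 𝓘.sold P d v l A = S} := by
  classical
  induction l generalizing A with
  | nil => simp [sold]
  | cons i l ih =>
    have : {v | 𝓘.sold P d v (i :: l) A = S} =
        ⋃ o : Option J, {v | d.choose (𝓘.menu P i A) v = o} ∩
          {v | 𝓘.sold P d v l (o.elim A fun j => insert j A) = S} := by
      ext v
      simp only [Set.mem_ofPred_eq, Set.mem_iUnion, Set.mem_inter_iff, exists_eq_left']
      rcases h : d.choose (𝓘.menu P i A) v with _ | j
      · rw [sold_cons_of_none h]
        rfl
      · rw [sold_cons_of_some h]
        rfl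
    rw [this]
    exact MeasurableSet.iUnion fun o => (d.measurable _ o).inter (ih _)

open Classical in
theorem utility_menuMechanism (σ : ArrivalOrder I) {i : I} {x b : J → ℝ≥0} {o : Option J}
    (h : (𝓘.sold P d b σ.1 ∅).filter (fun j => 𝓘.owner j = i) = o.toFinset) :
    𝓘.utility (𝓘.menuMechanism P d σ) i x b = o.elim 0 fun j => (x j : ℝ) - P.price j := by
  simp only [utility, menuMechanism, h]
  cases o <;> simp

theorem isTruthfulMechanism_menuMechanism (d : DemandRule P.price) (σ : ArrivalOrder I) :
    𝓘.IsTruthfulMechanism (𝓘.menuMechanism P d σ) where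
  measurable := by
    classical
    refine ⟨measurableSet_sold_eq d σ.1 ∅, fun i => ?_⟩
    let _ : MeasurableSpace (Finset J) := ⊤
    have hs : Measurable fun v : J → ℝ≥0 => 𝓘.sold P d v σ.1 ∅ :=
      measurable_to_countable' fun S => measurableSet_sold_eq d σ.1 ∅ S
    exact (measurable_from_top (f := fun S : Finset J =>
      ∑ j ∈ S.filter (fun j => 𝓘.owner j = i), (P.price j : ℝ))).comp hs
  feasible v := P.allowed_subset (sold_mem_allowed v _ P.empty_mem)
  truthful i v b hb := by
    classical
    -- A misreport changes only the choice from a fixed menu, and the demand rule is optimal on it.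
    obtain ⟨A, hA⟩ := exists_filter_sold_eq d σ i v
    rw [utility_menuMechanism σ (hA b hb).2, utility_menuMechanism σ (hA v fun _ _ => rfl).2]
    rcases hv : d.choose (𝓘.menu P i A) v with _ | j <;>
      rcases hb' : d.choose (𝓘.menu P i A) b with _ | k
    · simp
    · have := d.lt_price _ _ hv k (d.mem _ _ _ hb')
      simpa using this.le
    · simpa using d.price_le _ _ _ hv
    · exact d.optimal _ _ _ hv k (d.mem _ _ _ hb')
  pay_le v j hj := by
    classical
    change j ∈ 𝓘.sold P d v σ.1 ∅ at hj
    have hf : (𝓘.sold P d v σ.1 ∅).filter (fun k => 𝓘.owner k = 𝓘.owner j) = {j} := by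
      ext k
      simp only [Finset.mem_filter, Finset.mem_singleton]
      constructor
      · rintro ⟨hk, h⟩
        exact 𝓘.unit_demand _ (P.allowed_subset (sold_mem_allowed v _ P.empty_mem)) k hk j hj h
      · rintro rfl
        exact ⟨hj, rfl⟩
    have := price_le_of_mem_sold v _ (by simp) j hj
    simpa [menuMechanism, hf] using this
  pay_zero v i h := by
    classical
    have hf : (𝓘.sold P d v σ.1 ∅).filter (fun j => 𝓘.owner j = i) = ∅ :=
      Finset.filter_eq_empty_iff.2 h
    simp [menuMechanism, hf]

theorem revenue_menuMechanism (d : DemandRule P.price) (σ : ArrivalOrder I) :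
    (𝓘.menuMechanism P d σ).revenue 𝓘.dist =
      ((∫⁻ v, ∑ j ∈ 𝓘.sold P d v σ.1 ∅, (P.price j : ℝ≥0∞)
        ∂(Measure.pi fun j => (𝓘.dist j : Measure ℝ≥0)) : ℝ≥0∞) : EReal) := by
  classical
  have hsum : ∀ v, ∑ i, (𝓘.menuMechanism P d σ).pay v i =
      ((∑ j ∈ 𝓘.sold P d v σ.1 ∅, P.price j : ℝ≥0) : ℝ) := fun v => by
    rw [NNReal.coe_sum]
    exact Finset.sum_fiberwise _ _ _
  unfold Mechanism.revenue
  simp only [hsum]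
  rw [extendedExpectation_of_nonneg _ fun v => NNReal.coe_nonneg _]
  simp only [ENNReal.ofReal_coe_nnreal, ENNReal.ofNNReal_finsetSum]

theorem menuObliviousRevenue_le_revenue (d : DemandRule P.price) (σ : ArrivalOrder I) :
    (𝓘.menuObliviousRevenue P d : EReal) ≤ (𝓘.menuMechanism P d σ).revenue 𝓘.dist := by
  rw [revenue_menuMechanism]
  exact EReal.coe_ennreal_le_coe_ennreal_iff.2 (lintegral_mono fun v => iInf_le _ σ)

/-- Each order's sold set competes in the minimum over maximal sets, so the bound is pointwise and
survives an adversary who sees `v`. -/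
theorem opmRevenue_le_menuObliviousRevenue (𝓘 : BMUMD I J) (P : OPM 𝓘.copies.feasible)
    (d : DemandRule P.price) : 𝓘.copies.opmRevenue P ≤ 𝓘.menuObliviousRevenue P d :=
  lintegral_mono fun v => le_iInf fun σ => iInf₂_le _ (sold_mem_maximalSets d σ v)

end Menu

end BMUMD

theorem mainTheorem4 {I J : Type*} [Fintype I] [Fintype J] (𝓘 : BMUMD I J) (α : ℝ≥0)
    (P : OPM 𝓘.copies.feasible)
    (hP : 𝓘.copies.optRevenue ≤ ((α : ℝ) : EReal) * (𝓘.copies.opmRevenue P : EReal))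
    (d : DemandRule P.price) :
    (∀ σ : ArrivalOrder I,
      𝓘.IsTruthfulMechanism (𝓘.menuMechanism P d σ) ∧
      𝓘.optRevenue ≤ ((α : ℝ) : EReal) * (𝓘.menuMechanism P d σ).revenue 𝓘.dist) ∧
    𝓘.optRevenue ≤ ((α : ℝ) : EReal) * (𝓘.menuObliviousRevenue P d : EReal) := by
  have hα : (0 : EReal) ≤ ((α : ℝ) : EReal) := EReal.coe_nonneg.2 α.coe_nonneg
  have h : 𝓘.optRevenue ≤ ((α : ℝ) : EReal) * (𝓘.menuObliviousRevenue P d : EReal) :=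
    (𝓘.optRevenue_le_copies.trans hP).trans (mul_le_mul_of_nonneg_left
      (EReal.coe_ennreal_le_coe_ennreal_iff.2
        (BMUMD.opmRevenue_le_menuObliviousRevenue 𝓘 P d)) hα)
  exact ⟨fun σ => ⟨BMUMD.isTruthfulMechanism_menuMechanism d σ, h.trans
    (mul_le_mul_of_nonneg_left (BMUMD.menuObliviousRevenue_le_revenue d σ) hα)⟩, h⟩
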